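/- Let $V$ be a finite-dimensional vector space over a field $\Bbbk$, let $\mathbf c=(c_1,\dots,c_m)\in\mathbb N^m$, and let $\mathcal X=(X_1,\dots,X_m)$ be a list of subspaces of $V$ with $\operatorname{codim}X_i=c_i$. **Definitions.** A *U-matroid* $(E,\mathcal D,\rho)$ consists of a finite set $E$, a family $\mathcal D\subseteq 2^E$ containing $\emptyset$ and $E$, closed under union and intersection, and accessible (every nonempty $A\in\mathcal D$ has an $x\in A$ with $A\setminus\{x\}\in\mathcal D$), and a function $\rho:\mathcal D\to\mathbb N$ with $\rho(\emptyset)=0$ that is monotone, submodular, and satisfies $\rho(A\cup\{x\})\le\rho(A)+1$ whenever $A,A\cup\{x\}\in\mathcal D$. If $\{a\}\notin\mathcal D$, the *generous atom extension* of $\rho$ by $a$ is the function $\rho_a$ on $\mathcal D[a]=\mathcal D\cup\{S\cup\{a\}:S\in\mathcal D\}$ given by $\rho_a(S)=\rho(S)$ for $S\in\mathcal D$ and, for $S\notin\mathcal D$, by $\rho_a(S)=\rho(S\setminus a)+1$ if $\rho(S\setminus a)<\rho(\sup_{\mathcal D}S)$ and $\rho_a(S)=\rho(S\setminus a)$ if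 $\rho(S\setminus a)=\rho(\sup_{\mathcal D}S)$, where $\sup_{\mathcal D}S=\bigcap\{B\in\mathcal D:B\supseteq S\}$. The *generous matroid extension* $\hat\rho$ of $\rho$ is obtained by iterating this over all $a\in E$ with $\{a\}\notin\mathcal D$, in any order. Let $E=E_1\sqcup\dots\sqcup E_m$ with each $E_i$ a chain of $c_i$ elements, and let $\pi:E\to[m]$ be the map with $\pi^{-1}(i)=E_i$. Identify $\mathbf b\in\mathcal D_{\mathbf c}=[0,c_1]\times\dots\times[0,c_m]$ with the set of the first $b_i$ elements of each $E_i$. The *U-matroid of $\mathcal X$* is $U=(E,\mathcal D_{\mathbf c},\rho_{\mathcal X})$, where $$\rho_{\mathcal X}(\mathbf b)=\max\{\operatorname{codim}(Y_1\cap\dots\cap Y_m): Y_i\supseteq X_i\text{ subspaces of }V,\ \operatorname{codim}Y_i=b_i\}.$$ The *polymatroid of $\mathcal X$* is $\operatorname{rk}_{\mathcal X}(A)=\operatorname{codim}\bigcap_{a\in A}X_a$ for $A\subseteq[m]$, and its *minimal multisymmetric lift* is the matroid $M$ on $E$ with rank function $$\operatorname{rk}_M(S)=\min_{A\subseteq[m]}\bigl(\operatorname{rk}_{\mathcal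 X}(A)+|S\setminus\pi^{-1}(A)|\bigr),\qquad S\subseteq E.$$ **Theorem.** $U$ is a U-matroid, $\operatorname{rk}_{\mathcal X}$ is an integral polymatroid with $\operatorname{rk}_{\mathcal X}(\{i\})=|E_i|$, and $\operatorname{rk}_M$ is the rank function of a matroid $M$, which is the generous matroid extension of $U$: for every order in which the elements $a$ with $\{a\}\notin\mathcal D_{\mathbf c}$ are adjoined, the iterated generous atom extension is defined on all of $2^E$ and equals $\operatorname{rk}_M$. In particular, for all $S\subseteq E$, $$\hat\rho_{\mathcal X}(S)=\min_{A\subseteq[m]}\bigl(\operatorname{rk}_{\mathcal X}(A)+|S\setminus\pi^{-1}(A)|\bigr)=\min_{A\subseteq[m]}\bigl(\rho_{\mathcal X}(\pi^{-1}(A))+|S\setminus\pi^{-1}(A)|\bigr).$$ -/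

import Mathlib

open Finset

/-- A family `lattice` of subsets of `E` with an `ℕ`-valued function on it. The function is written
on all finite subsets of `E`, but only its values on members of `lattice` are meaningful. -/
structure RankedLattice (E : Type*) where
  lattice : Set (Finset E)
  rank : Finset E → ℕ

namespace RankedLattice

variable {E : Type*}

/-- Equality as ranked lattices: same lattice, and same rank function on that lattice. -/
def Same (U W : RankedLattice E) : Prop :=
  U.lattice = W.lattice ∧ ∀ A ∈ U.lattice, U.rank A = W.rank A

variable [Fintype E] [DecidableEq E]

/-- `(E, 𝒟, ρ)` is a U-matroid: `𝒟` is an accessible distributive sublattice of `2^E` containing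
`∅` and `E`, and `ρ : 𝒟 → ℕ` is calibrated, monotone, submodular and has unit increase. -/
structure IsUMatroid (U : RankedLattice E) : Prop where
  empty_mem : ∅ ∈ U.lattice
  univ_mem : univ ∈ U.lattice
  union_mem : ∀ A ∈ U.lattice, ∀ B ∈ U.lattice, A ∪ B ∈ U.lattice
  inter_mem : ∀ A ∈ U.lattice, ∀ B ∈ U.lattice, A ∩ B ∈ U.lattice
  accessible : ∀ A ∈ U.lattice, A.Nonempty → ∃ x ∈ A, A.erase x ∈ U.lattice
  rank_empty : U.rank ∅ = 0
  rank_mono : ∀ A ∈ U.lattice, ∀ B ∈ U.lattice, A ⊆ B → U.rank A ≤ U.rank B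
  rank_submod : ∀ A ∈ U.lattice, ∀ B ∈ U.lattice,
    U.rank (A ∪ B) + U.rank (A ∩ B) ≤ U.rank A + U.rank B
  unit_increase : ∀ A ∈ U.lattice, ∀ x : E, insert x A ∈ U.lattice →
    U.rank (insert x A) ≤ U.rank A + 1

open scoped Classical in
/-- `sup_𝒟(S) = ⋂ {B ∈ 𝒟 | S ⊆ B}`. -/
noncomputable def sup (U : RankedLattice E) (S : Finset E) : Finset E :=
  univ.filter fun x => ∀ B ∈ U.lattice, S ⊆ B → x ∈ B

open scoped Classical in
/-- The generous atom extension of `(E, 𝒟, ρ)` to `𝒟[a] = 𝒟 ∪ {S ∪ {a} | S ∈ 𝒟}`. -/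
noncomputable def generousAtomExtension (U : RankedLattice E) (a : E) : RankedLattice E where
  lattice := U.lattice ∪ {T | ∃ S ∈ U.lattice, T = insert a S}
  rank S :=
    if S ∈ U.lattice then U.rank S
    else if U.rank (S.erase a) < U.rank (U.sup S) then U.rank (S.erase a) + 1
    else U.rank (S.erase a)

/-- The iterated generous atom extension `(((ρ_{a₁})_{a₂})…)_{aₖ}` along a list `a₁, …, aₖ`. -/
noncomputable def iteratedGenerousExtension (U : RankedLattice E) (l : List E) :
    RankedLattice E :=
  l.foldl generousAtomExtension U

/-- `l` lists, in some order and without repetition, the elements of `E ∖ Atom(𝒟)`, that is, those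
`a` for which `{a} ∉ 𝒟`. -/
def ListsNonAtoms (U : RankedLattice E) (l : List E) : Prop :=
  l.Nodup ∧ ∀ a : E, a ∈ l ↔ {a} ∉ U.lattice

/-- The matroid `M` on `E` is the generous matroid extension of `U`: for every ordering of the
non-atoms, the iterated generous atom extension is defined on all of `2^E` and its rank function is
the rank function of `M`. -/
def IsGenerousMatroidExtension (U : RankedLattice E) (M : Matroid E) : Prop :=
  M.E = Set.univ ∧ ∀ l : List E, U.ListsNonAtoms l →
    (U.iteratedGenerousExtension l).lattice = Set.univ ∧
    ∀ S : Finset E, M.eRk (S : Set E) = ((U.iteratedGenerousExtension l).rank S : ℕ∞)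

end RankedLattice

/-- Rank functions of integral polymatroids on a finite set `ι`. -/
structure IsIntegralPolymatroid {ι : Type*} [DecidableEq ι] (r : Finset ι → ℕ) : Prop where
  empty : r ∅ = 0
  mono : ∀ A B : Finset ι, A ⊆ B → r A ≤ r B
  submod : ∀ A B : Finset ι, r (A ∪ B) + r (A ∩ B) ≤ r A + r B

/-- `min {r(A) + |S ∖ π⁻¹(A)| : A ⊆ ι}`, for a map `π : E → ι`. -/
def liftRank {ι E : Type*} [Fintype ι] [DecidableEq ι] (r : Finset ι → ℕ) (π : E → ι)
    (S : Finset E) : ℕ :=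
  (univ : Finset (Finset ι)).inf' univ_nonempty fun A => r A + #(S.filter fun x => π x ∉ A)

/-- The matroid `M` on `E = ⨆ π⁻¹(i)` is the minimal multisymmetric lift of the integral
polymatroid `r`: the fibre `π⁻¹(i)` has `r({i})` elements, and
`rk_M(S) = min {r(A) + |S ∖ π⁻¹(A)| : A ⊆ ι}` for all `S ⊆ E`. -/
structure IsMinimalMultisymmetricLift {ι E : Type*} [Fintype ι] [DecidableEq ι] [Fintype E]
    (r : Finset ι → ℕ) (π : E → ι) (M : Matroid E) : Prop where
  polymatroid : IsIntegralPolymatroid r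
  card_fibre : ∀ i : ι, #(univ.filter fun x => π x = i) = r {i}
  ground : M.E = Set.univ
  rank_eq : ∀ S : Finset E, M.eRk (S : Set E) = (liftRank r π S : ℕ∞)

section Arrangement

variable {𝕜 V : Type*} [Field 𝕜] [AddCommGroup V] [Module 𝕜 V]

/-- Codimension of a subspace (used for finite-dimensional `V`). -/
noncomputable def codim (W : Submodule 𝕜 V) : ℕ := Module.finrank 𝕜 (V ⧸ W)

/-- The rank function `A ↦ codim (⋂_{a ∈ A} X_a)` of a subspace arrangement. -/
noncomputable def arrangementRk {m : ℕ} (X : Fin m → Submodule 𝕜 V) (A : Finset (Fin m)) : ℕ :=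
  codim (⨅ a ∈ A, X a)

/-- The set of numbers `codim (Y₁ ∩ ⋯ ∩ Yₘ)`, over all lists of subspaces `Yᵢ ⊇ Xᵢ` with
`codim Yᵢ = bᵢ`. -/
def codimValues {m : ℕ} (X : Fin m → Submodule 𝕜 V) (b : Fin m → ℕ) : Set ℕ :=
  {k | ∃ Y : Fin m → Submodule 𝕜 V, (∀ i, X i ≤ Y i ∧ codim (Y i) = b i) ∧ k = codim (⨅ i, Y i)}

/-- `ρ_X(b) = max {codim (Y₁ ∩ ⋯ ∩ Yₘ) | Yᵢ ⊇ Xᵢ, codim Yᵢ = bᵢ}`; used for `0 ≤ bᵢ ≤ codim Xᵢ`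
and `V` finite-dimensional, when the maximum is over a nonempty bounded set. -/
noncomputable def arrangementRho {m : ℕ} (X : Fin m → Submodule 𝕜 V) (b : Fin m → ℕ) : ℕ :=
  sSup (codimValues X b)

/-- The maximum in the definition of `arrangementRho` is attained. -/
theorem arrangementRho_isGreatest [FiniteDimensional 𝕜 V] {m : ℕ} (X : Fin m → Submodule 𝕜 V)
    (b : Fin m → ℕ) (hb : ∀ i, b i ≤ codim (X i)) :
    IsGreatest (codimValues X b) (arrangementRho X b) := by
  have hbdd : BddAbove (codimValues X b) := by
    refine ⟨Module.finrank 𝕜 V, ?_⟩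
    rintro k ⟨Y, -, rfl⟩
    exact Submodule.finrank_quotient_le _
  have hne : (codimValues X b).Nonempty := by
    have key : ∀ i, ∃ Y : Submodule 𝕜 V, X i ≤ Y ∧ codim Y = b i := by
      intro i
      obtain ⟨f, hf⟩ := exists_linearIndependent_of_le_finrank (R := 𝕜) (M := V ⧸ X i)
        (n := codim (X i) - b i) (Nat.sub_le _ _)
      have hW : Module.finrank 𝕜 (Submodule.span 𝕜 (Set.range f)) = codim (X i) - b i := by
        rw [finrank_span_eq_card hf]; simp
      generalize Submodule.span 𝕜 (Set.range f) = W at hW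
      have hle : X i ≤ W.comap (X i).mkQ := by
        intro x hx
        simp [Submodule.mem_comap, (Submodule.Quotient.mk_eq_zero (X i)).2 hx]
      refine ⟨W.comap (X i).mkQ, hle, ?_⟩
      have h1 := (Submodule.quotientQuotientEquivQuotient (X i) _ hle).finrank_eq
      rw [Submodule.map_comap_eq_of_surjective (Submodule.mkQ_surjective (X i))] at h1
      have h2 := Submodule.finrank_quotient_add_finrank W
      have h3 := hb i
      unfold codim at *
      omega
    choose Y hY using key
    exact ⟨_, Y, hY, rfl⟩
  exact ⟨Nat.sSup_mem hne hbdd, fun k hk => le_csSup hbdd hk⟩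

variable {m : ℕ} {c : Fin m → ℕ} {E : Type*} [Fintype E]

/-- The element `b ∈ [0,c₁] × ⋯ × [0,cₘ]` as a subset of `E`: the first `bᵢ` elements of the `i`-th
chain, where `e` identifies `E` with the disjoint union of chains of sizes `c₁, …, cₘ`. -/
def chainSet (e : (Σ i, Fin (c i)) ≃ E) (b : Fin m → ℕ) : Finset E :=
  univ.filter fun x => ((e.symm x).2 : ℕ) < b (e.symm x).1

/-- The index of the chain containing a given element. -/
def chainIndex (e : (Σ i, Fin (c i)) ≃ E) (x : E) : Fin m := (e.symm x).1

/-- The U-matroid of a `c`-arrangement `X`: the product of chains `[0,c₁] × ⋯ × [0,cₘ]` realized in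
`2^E`, where the element `b` (which has `bᵢ` elements in the `i`-th chain) has rank `ρ_X(b)`. -/
noncomputable def arrangementUMatroid (X : Fin m → Submodule 𝕜 V)
    (e : (Σ i, Fin (c i)) ≃ E) : RankedLattice E where
  lattice := {A | ∃ b : Fin m → ℕ, (∀ i, b i ≤ c i) ∧ A = chainSet e b}
  rank A := arrangementRho X fun i => #(A.filter fun x => chainIndex e x = i)

/-- The rank in `arrangementUMatroid` of the element `b` is `ρ_X(b)`. -/
theorem arrangementUMatroid_rank_chainSet (X : Fin m → Submodule 𝕜 V)
    (e : (Σ i, Fin (c i)) ≃ E) (b : Fin m → ℕ) (hb : ∀ i, b i ≤ c i) :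
    (arrangementUMatroid X e).rank (chainSet e b) = arrangementRho X b := by
  unfold arrangementUMatroid
  dsimp only
  congr 1
  funext i
  have : ((chainSet e b).filter fun x => chainIndex e x = i)
      = (univ.filter fun j : Fin (c i) => (j : ℕ) < b i).map
        ⟨fun j => e ⟨i, j⟩, fun j k h => by simpa using h⟩ := by
    ext x
    rw [mem_filter, chainSet, mem_filter]
    simp only [chainIndex, mem_univ, true_and, mem_map, mem_filter]
    change _ ↔ ∃ a : Fin (c i), (a : ℕ) < b i ∧ e ⟨i, a⟩ = x
    simp only [← Equiv.eq_symm_apply]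
    generalize e.symm x = p
    obtain ⟨k, j⟩ := p
    constructor
    · rintro ⟨h, rfl⟩
      exact ⟨j, h, rfl⟩
    · rintro ⟨j', h, h'⟩
      cases h'
      exact ⟨h, rfl⟩
  rw [this, card_map, Fin.card_filter_val_lt]
  exact min_eq_right (hb i)

end Arrangement

/-! Two facts carry the theorem.

Rado's theorem for subspaces: `ρ_X(b) = min_A (rk_X(A) + ∑_{j ∉ A} b_j)`. The bound `≤` holds for
every admissible `Y`. For `≥`, the `X i` are enlarged one dimension at a time while all the Rado
inequalities are kept (`exists_enlargement`). With `b i` the size of the part of `S` in the `i`-th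
fibre, the right side is `liftRank` of `S`, so the rank of the U-matroid is the restriction of
`rk_M`. Since `rk_M` is a matroid rank function, the U-matroid axioms on ranks follow.

Forced extension: let `r` be a matroid rank function for which elements of one fibre are clones, and
let a lattice containing all fibres carry the restriction of `r`. Adjoining `a` to a member `S`
raises `r` unless `a` lies in the closure of `S`. In that case the closure contains the whole fibre
`F` of `a`, and as `S ∪ F` is a member, the rank of the supremum is `r S`. This is the generous
rule, so each atom extension again restricts `r`. Once every singleton is present the lattice is
`2^E`, and the order of adjunction does not matter. -/

/-! ### Matroids from rank functions. -/

/-- Rank functions of matroids on a finite set `E`, on all finite subsets of `E`. -/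
structure IsMatroidRank {E : Type*} [DecidableEq E] (r : Finset E → ℕ) : Prop where
  empty : r ∅ = 0
  mono : ∀ A B : Finset E, A ⊆ B → r A ≤ r B
  submod : ∀ A B : Finset E, r (A ∪ B) + r (A ∩ B) ≤ r A + r B
  insert_le : ∀ (A : Finset E) (x : E), r (insert x A) ≤ r A + 1

namespace IsMatroidRank

variable {E : Type*} [DecidableEq E] {r : Finset E → ℕ}

theorem le_card (hr : IsMatroidRank r) (A : Finset E) : r A ≤ #A := by
  induction A using Finset.induction_on with
  | empty => simp [hr.empty]
  | insert a s ha ih =>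
    have := hr.insert_le s a
    rw [card_insert_of_notMem ha]
    omega

/-- If no single element of `T` raises the rank of `S`, then `T` does not raise it. -/
theorem union_eq_of_forall_insert_eq (hr : IsMatroidRank r) {S : Finset E} (T : Finset E)
    (h : ∀ x ∈ T, r (insert x S) = r S) : r (S ∪ T) = r S := by
  induction T using Finset.induction_on with
  | empty => simp
  | insert a T ha ih =>
    have h1 := ih fun x hx => h x (mem_insert_of_mem hx)
    have h2 := h a (mem_insert_self a T)
    have h3 := hr.submod (S ∪ T) (insert a S)
    have h4 : S ∪ T ∪ insert a S = S ∪ insert a T := by grind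
    have h5 := hr.mono S ((S ∪ T) ∩ insert a S) (by grind)
    have h6 := hr.mono S (S ∪ insert a T) subset_union_left
    rw [h4] at h3
    omega

theorem eq_card_of_subset (hr : IsMatroidRank r) {I J : Finset E} (hJ : r J = #J) (hIJ : I ⊆ J) :
    r I = #I := by
  have h1 := hr.submod I (J \ I)
  rw [union_sdiff_of_subset hIJ] at h1
  have h2 := hr.le_card (J \ I)
  have h3 := card_sdiff_add_card_eq_card hIJ
  have h4 := hr.le_card I
  omega

/-- The matroid with a given rank function. -/
theorem exists_matroid (hr : IsMatroidRank r) :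
    ∃ M : Matroid E, M.E = Set.univ ∧ ∀ S : Finset E, M.eRk (S : Set E) = (r S : ℕ∞) := by
  let N : IndepMatroid E := IndepMatroid.ofFinset Set.univ (fun I => r I = #I)
    (by simp [hr.empty])
    (fun I J hJ hIJ => hr.eq_card_of_subset hJ hIJ)
    (by
      intro I J hI hJ hIJ
      -- If no element of `J` augments `I`, then `J` lies in the closure of `I`, so `#J = r J ≤ r I
      -- = #I`.
      by_contra! hcon
      have h1 : r (I ∪ J) = r I := by
        refine hr.union_eq_of_forall_insert_eq J fun x hx => ?_
        by_cases hxI : x ∈ I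
        · rw [insert_eq_of_mem hxI]
        · have h2 := hcon x hx hxI
          have h3 := hr.insert_le I x
          have h4 := hr.mono I (insert x I) (subset_insert x I)
          rw [card_insert_of_notMem hxI] at h2
          omega
      have h2 := hr.mono J (I ∪ J) subset_union_right
      omega)
    (fun I _ => Set.subset_univ _)
  have hN : ∀ I : Finset E, N.matroid.Indep I ↔ r I = #I := fun I => by
    rw [IndepMatroid.matroid_Indep]
    apply IndepMatroid.ofFinset_indep
  refine ⟨N.matroid, rfl, fun S => ?_⟩
  obtain ⟨I, hI⟩ := N.matroid.exists_isBasis (S : Set E) (Set.subset_univ _)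
  obtain ⟨I, rfl⟩ := (S.finite_toSet.subset hI.subset).exists_finset_coe
  have hIS : I ⊆ S := by exact_mod_cast hI.subset
  have hIr := (hN I).1 hI.indep
  have h1 : r (I ∪ S) = r I := by
    refine hr.union_eq_of_forall_insert_eq S fun x hx => ?_
    by_cases hxI : x ∈ I
    · rw [insert_eq_of_mem hxI]
    · have h2 := (hI.insert_dep (e := x) ⟨by simpa using hx, by simpa using hxI⟩).not_indep
      rw [← coe_insert, hN, card_insert_of_notMem hxI] at h2
      have h3 := hr.insert_le I x
      have h4 := hr.mono I (insert x I) (subset_insert x I)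
      omega
  rw [union_eq_right.2 hIS] at h1
  rw [← hI.encard_eq_eRk, Set.encard_coe_eq_coe_finsetCard, h1, hIr]

end IsMatroidRank

/-! ### Integral polymatroids and their lifts. -/

theorem IsIntegralPolymatroid.le_add_sum {ι : Type*} [DecidableEq ι] {r : Finset ι → ℕ}
    (hr : IsIntegralPolymatroid r) (A B : Finset ι) : r (A ∪ B) ≤ r A + ∑ i ∈ B, r {i} := by
  induction B using Finset.induction_on with
  | empty => simp
  | insert i B hi ih =>
    have h := hr.submod (A ∪ B) {i}
    have h2 : A ∪ B ∪ {i} = A ∪ insert i B := by grind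
    rw [sum_insert hi]
    rw [h2] at h
    omega

section LiftRank

variable {ι E : Type*} [Fintype ι] [DecidableEq ι] {r : Finset ι → ℕ} {π : E → ι}

theorem liftRank_le (r : Finset ι → ℕ) (π : E → ι) (S : Finset E) (A : Finset ι) :
    liftRank r π S ≤ r A + #(S.filter fun x => π x ∉ A) :=
  inf'_le _ (mem_univ A)

theorem exists_liftRank_eq (r : Finset ι → ℕ) (π : E → ι) (S : Finset E) :
    ∃ A : Finset ι, liftRank r π S = r A + #(S.filter fun x => π x ∉ A) := by
  obtain ⟨A, -, hA⟩ := exists_mem_eq_inf' (univ_nonempty : (univ : Finset (Finset ι)).Nonempty)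
    fun A => r A + #(S.filter fun x => π x ∉ A)
  exact ⟨A, hA⟩

theorem card_filter_notMem_eq_sum (π : E → ι) (S : Finset E) (A : Finset ι) :
    #(S.filter fun x => π x ∉ A) = ∑ i ∈ Aᶜ, #(S.filter fun x => π x = i) := by
  rw [card_eq_sum_card_fiberwise (f := π) (t := Aᶜ) (by intro x; simp)]
  refine sum_congr rfl fun i hi => congrArg card ?_
  ext x
  simp only [mem_filter, mem_compl] at hi ⊢
  grind

/-- Elements of the same fibre are clones. -/
theorem liftRank_insert_eq_insert [DecidableEq E] (r : Finset ι → ℕ) {S : Finset E} {a x : E}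
    (hax : π a = π x) (ha : a ∉ S) (hx : x ∉ S) :
    liftRank r π (insert a S) = liftRank r π (insert x S) := by
  unfold liftRank
  congr 1
  funext A
  rw [filter_insert, filter_insert, hax]
  split_ifs
  · rfl
  · rw [card_insert_of_notMem (by simp [ha]), card_insert_of_notMem (by simp [hx])]

theorem IsIntegralPolymatroid.isMatroidRank_liftRank [DecidableEq E]
    (hr : IsIntegralPolymatroid r) (π : E → ι) : IsMatroidRank (liftRank r π) where
  empty := by simpa [hr.empty] using liftRank_le r π ∅ ∅
  mono S T hST := by
    obtain ⟨A, hA⟩ := exists_liftRank_eq r π T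
    rw [hA]
    exact (liftRank_le r π S A).trans
      (Nat.add_le_add_left (card_le_card (filter_subset_filter _ hST)) _)
  submod S T := by
    obtain ⟨A, hA⟩ := exists_liftRank_eq r π S
    obtain ⟨B, hB⟩ := exists_liftRank_eq r π T
    -- The minimizers `A` of `S` and `B` of `T` are uncrossed: their union tests `S ∪ T`, their
    -- intersection `S ∩ T`.
    have h1 := liftRank_le r π (S ∪ T) (A ∪ B)
    have h2 := liftRank_le r π (S ∩ T) (A ∩ B)
    have h3 := hr.submod A B
    have h4 : #((S ∪ T).filter fun x => π x ∉ A ∪ B) + #((S ∩ T).filter fun x => π x ∉ A ∩ B)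
        ≤ #(S.filter fun x => π x ∉ A) + #(T.filter fun x => π x ∉ B) := by
      rw [← card_union_add_card_inter (S.filter fun x => π x ∉ A)]
      rw [← card_union_add_card_inter ((S ∪ T).filter fun x => π x ∉ A ∪ B)]
      refine Nat.add_le_add (card_le_card ?_) (card_le_card ?_)
      · intro x; simp only [mem_union, mem_inter, mem_filter]; tauto
      · intro x; simp only [mem_union, mem_inter, mem_filter]; tauto
    omega
  insert_le S x := by
    obtain ⟨A, hA⟩ := exists_liftRank_eq r π S
    have h1 := liftRank_le r π (insert x S) A
    have h2 : #((insert x S).filter fun x => π x ∉ A) ≤ #(S.filter fun x => π x ∉ A) + 1 := by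
      rw [filter_insert]
      split_ifs
      · exact Nat.le_succ _
      · exact card_insert_le _ _
    omega

/-- Testing with another set `B` gains nothing: each `i ∈ A \ B` costs its full fibre, of size `r
{i}`, and by subadditivity these costs make up for replacing `A` by `B`. This identifies the two
minimum formulas of the theorem. -/
theorem IsIntegralPolymatroid.liftRank_preimage [Fintype E] (hr : IsIntegralPolymatroid r)
    (hπ : ∀ i : ι, #(univ.filter fun x => π x = i) = r {i}) (A : Finset ι) :
    liftRank r π (univ.filter fun x => π x ∈ A) = r A := by
  apply le_antisymm
  · simpa [filter_filter] using liftRank_le r π (univ.filter fun x => π x ∈ A) A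
  · obtain ⟨B, hB⟩ := exists_liftRank_eq r π (univ.filter fun x => π x ∈ A)
    rw [hB, card_filter_notMem_eq_sum]
    have h1 := hr.le_add_sum B (A \ B)
    have h2 := hr.mono A (B ∪ A \ B) (by grind)
    have h3 : ∑ i ∈ A \ B, r {i} ≤
        ∑ i ∈ Bᶜ, #((univ.filter fun x => π x ∈ A).filter fun x => π x = i) := by
      refine (sum_le_sum fun i hi => ?_).trans
        (sum_le_sum_of_subset (by intro i; simp only [mem_sdiff, mem_compl]; tauto))
      rw [← hπ i]
      refine card_le_card fun x => ?_
      simp only [mem_filter, mem_univ, true_and, mem_sdiff] at hi ⊢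
      rintro rfl
      exact ⟨hi.1, rfl⟩
    omega

end LiftRank

/-! ### Generous extensions restrict the matroid rank. -/

namespace RankedLattice

theorem lattice_eq_univ_of_singleton_mem {E : Type*} [DecidableEq E] {U : RankedLattice E} (hempty : ∅ ∈ U.lattice)
    (hunion : ∀ A ∈ U.lattice, ∀ B ∈ U.lattice, A ∪ B ∈ U.lattice)
    (h : ∀ a, {a} ∈ U.lattice) : U.lattice = Set.univ := by
  refine Set.eq_univ_of_forall fun S => ?_
  induction S using Finset.induction_on with
  | empty => exact hempty
  | insert a S _ ih => exact hunion {a} (h a) S ih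

variable {E : Type*} [Fintype E] [DecidableEq E]

/-- The part of the U-matroid structure on which the generous extension to the matroid with rank
function `r` rests; it is preserved by generous atom extensions. -/
structure RestrictsRank {ι : Type*} [DecidableEq ι] (r : Finset E → ℕ) (π : E → ι)
    (U : RankedLattice E) : Prop where
  empty_mem : ∅ ∈ U.lattice
  fibre_mem : ∀ i, (univ.filter fun x => π x = i) ∈ U.lattice
  univ_mem : univ ∈ U.lattice
  union_mem : ∀ A ∈ U.lattice, ∀ B ∈ U.lattice, A ∪ B ∈ U.lattice
  inter_mem : ∀ A ∈ U.lattice, ∀ B ∈ U.lattice, A ∩ B ∈ U.lattice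
  rank_eq : ∀ A ∈ U.lattice, U.rank A = r A

theorem subset_sup (U : RankedLattice E) (S : Finset E) : S ⊆ U.sup S := by
  intro x hx
  simp only [sup, mem_filter, mem_univ, true_and]
  exact fun B _ hB => hB hx

theorem sup_subset {U : RankedLattice E} {S B : Finset E} (hB : B ∈ U.lattice) (h : S ⊆ B) :
    U.sup S ⊆ B := by
  intro x hx
  simp only [sup, mem_filter, mem_univ, true_and] at hx
  exact hx B hB h

open scoped Classical in
theorem sup_mem {U : RankedLattice E} (huniv : univ ∈ U.lattice)
    (hinter : ∀ A ∈ U.lattice, ∀ B ∈ U.lattice, A ∩ B ∈ U.lattice) (S : Finset E) :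
    U.sup S ∈ U.lattice := by
  have key : ∀ F : Finset (Finset E), (∀ B ∈ F, B ∈ U.lattice) → F.inf id ∈ U.lattice := by
    intro F
    induction F using Finset.induction_on with
    | empty => intro _; simpa using huniv
    | insert B F _ ih =>
      intro h
      rw [inf_insert]
      exact hinter _ (h B (mem_insert_self _ _)) _ (ih fun C hC => h C (mem_insert_of_mem hC))
  have h := key (univ.filter fun B => B ∈ U.lattice ∧ S ⊆ B) (by simp +contextual)
  convert h using 1
  ext x
  simp [sup, Finset.mem_inf]

/-- The inductive step: the generous rule computes `r (insert a S)` correctly because the lattice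
contains the fibre of `a`, whose elements are clones. -/
theorem RestrictsRank.generousAtomExtension {ι : Type*} [DecidableEq ι] {r : Finset E → ℕ}
    {π : E → ι} {U : RankedLattice E} (hU : U.RestrictsRank r π) (hr : IsMatroidRank r)
    (hclone : ∀ (S : Finset E) (a x : E), π a = π x → a ∉ S → x ∉ S →
      r (insert a S) = r (insert x S)) (a : E) :
    (U.generousAtomExtension a).RestrictsRank r π where
  empty_mem := Or.inl hU.empty_mem
  fibre_mem i := Or.inl (hU.fibre_mem i)
  univ_mem := Or.inl hU.univ_mem
  union_mem := by
    rintro A (hA | ⟨S, hS, rfl⟩) B (hB | ⟨T, hT, rfl⟩)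
    · exact Or.inl (hU.union_mem A hA B hB)
    · exact Or.inr ⟨A ∪ T, hU.union_mem A hA T hT, by grind⟩
    · exact Or.inr ⟨S ∪ B, hU.union_mem S hS B hB, by grind⟩
    · exact Or.inr ⟨S ∪ T, hU.union_mem S hS T hT, by grind⟩
  inter_mem := by
    rintro A (hA | ⟨S, hS, rfl⟩) B (hB | ⟨T, hT, rfl⟩)
    · exact Or.inl (hU.inter_mem A hA B hB)
    · by_cases ha : a ∈ A
      · exact Or.inr ⟨A ∩ T, hU.inter_mem A hA T hT, by grind⟩
      · exact Or.inl ((by grind : A ∩ insert a T = A ∩ T) ▸ hU.inter_mem A hA T hT)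
    · by_cases ha : a ∈ B
      · exact Or.inr ⟨S ∩ B, hU.inter_mem S hS B hB, by grind⟩
      · exact Or.inl ((by grind : insert a S ∩ B = S ∩ B) ▸ hU.inter_mem S hS B hB)
    · exact Or.inr ⟨S ∩ T, hU.inter_mem S hS T hT, by grind⟩
  rank_eq := by
    intro A hA
    by_cases hAU : A ∈ U.lattice
    · simpa [RankedLattice.generousAtomExtension, hAU] using hU.rank_eq A hAU
    obtain ⟨S, hS, rfl⟩ := hA.resolve_left hAU
    have haS : a ∉ S := fun h => hAU (by rwa [insert_eq_of_mem h])
    simp only [RankedLattice.generousAtomExtension, if_neg hAU, erase_insert haS]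
    rw [hU.rank_eq S hS, hU.rank_eq _ (sup_mem hU.univ_mem hU.inter_mem _)]
    have h1 := hr.mono _ _ (U.subset_sup (insert a S))
    have h2 := hr.mono _ _ (subset_insert a S)
    have h3 := hr.insert_le S a
    split_ifs with hlt
    · by_contra hne
      have h4 : r (insert a S) = r S := by omega
      have h5 : r (S ∪ univ.filter fun x => π x = π a) = r S := by
        -- Every clone of `a` also fails to raise the rank of `S`. Hence the member `S ∪ F`, with
        -- `F` the fibre of `a`, has rank `r S`; it contains the supremum, contradicting `hlt`.
        refine hr.union_eq_of_forall_insert_eq _ fun x hx => ?_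
        by_cases hxS : x ∈ S
        · rw [insert_eq_of_mem hxS]
        · rw [hclone S x a (by simpa using hx) hxS haS, h4]
      have h6 := hr.mono _ _ (sup_subset (hU.union_mem S hS _ (hU.fibre_mem (π a)))
        (show insert a S ⊆ _ by
          refine insert_subset (mem_union_right _ (by simp)) subset_union_left))
      omega
    · omega

theorem RestrictsRank.iteratedGenerousExtension {ι : Type*} [DecidableEq ι] {r : Finset E → ℕ}
    {π : E → ι} (hr : IsMatroidRank r)
    (hclone : ∀ (S : Finset E) (a x : E), π a = π x → a ∉ S → x ∉ S →
      r (insert a S) = r (insert x S)) (l : List E) {U : RankedLattice E}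
    (hU : U.RestrictsRank r π) :
    (U.iteratedGenerousExtension l).RestrictsRank r π := by
  induction l generalizing U with
  | nil => exact hU
  | cons a l ih => exact ih (hU.generousAtomExtension hr hclone a)

theorem lattice_subset_iteratedGenerousExtension (l : List E) (U : RankedLattice E) :
    U.lattice ⊆ (U.iteratedGenerousExtension l).lattice := by
  induction l generalizing U with
  | nil => exact subset_rfl
  | cons a l ih => exact Set.subset_union_left.trans (ih (U.generousAtomExtension a))

theorem singleton_mem_iteratedGenerousExtension {l : List E} {U : RankedLattice E}
    (hU : ∅ ∈ U.lattice) {a : E} (ha : a ∈ l) :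
    {a} ∈ (U.iteratedGenerousExtension l).lattice := by
  induction l generalizing U with
  | nil => simp at ha
  | cons b l ih =>
    rcases List.mem_cons.1 ha with rfl | h
    · exact lattice_subset_iteratedGenerousExtension l (U.generousAtomExtension a)
        (Or.inr ⟨∅, hU, rfl⟩)
    · exact ih (U := U.generousAtomExtension b) (Or.inl hU) h

theorem RestrictsRank.lattice_iteratedGenerousExtension {ι : Type*} [DecidableEq ι]
    {r : Finset E → ℕ} {π : E → ι} {U : RankedLattice E} (hU : U.RestrictsRank r π)
    (hr : IsMatroidRank r)
    (hclone : ∀ (S : Finset E) (a x : E), π a = π x → a ∉ S → x ∉ S →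
      r (insert a S) = r (insert x S)) {l : List E} (hl : U.ListsNonAtoms l) :
    (U.iteratedGenerousExtension l).lattice = Set.univ := by
  have h := RestrictsRank.iteratedGenerousExtension hr hclone l hU
  refine lattice_eq_univ_of_singleton_mem h.empty_mem h.union_mem fun a => ?_
  by_cases ha : {a} ∈ U.lattice
  · exact lattice_subset_iteratedGenerousExtension l U ha
  · exact singleton_mem_iteratedGenerousExtension hU.empty_mem ((hl.2 a).2 ha)

end RankedLattice

/-! ### Codimension and Rado's theorem for subspaces. -/

section Codim

variable {𝕜 V : Type*} [Field 𝕜] [AddCommGroup V] [Module 𝕜 V] {m : ℕ}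

theorem sup_span_singleton_inf_eq {P Q : Submodule 𝕜 V} {v : V} (hv : v ∉ P ⊔ Q) :
    (P ⊔ Submodule.span 𝕜 {v}) ⊓ Q = P ⊓ Q := by
  refine le_antisymm (fun x hx => ⟨?_, hx.2⟩) (inf_le_inf_right _ le_sup_left)
  obtain ⟨p, hp, w, hw, rfl⟩ := Submodule.mem_sup.1 hx.1
  obtain ⟨t, rfl⟩ := Submodule.mem_span_singleton.1 hw
  have ht : t • v ∈ P ⊔ Q := by
    have := Submodule.sub_mem _ (Submodule.mem_sup_right (S := P) hx.2)
      (Submodule.mem_sup_left (T := Q) hp)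
    rwa [add_sub_cancel_left] at this
  by_cases h0 : t = 0
  · simpa [h0] using hp
  · exact absurd ((Submodule.smul_mem_iff _ h0).1 ht) hv

theorem arrangementRk_singleton (X : Fin m → Submodule 𝕜 V) (i : Fin m) :
    arrangementRk X {i} = codim (X i) := by
  simp [arrangementRk]

theorem arrangementRk_univ (X : Fin m → Submodule 𝕜 V) :
    arrangementRk X univ = codim (⨅ i, X i) := by
  simp [arrangementRk]

theorem arrangementRk_eq_of_mem (X : Fin m → Submodule 𝕜 V) {A : Finset (Fin m)} {i : Fin m}
    (hi : i ∈ A) : arrangementRk X A = codim (X i ⊓ ⨅ a ∈ A.erase i, X a) := by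
  rw [arrangementRk, ← Finset.iInf_insert, insert_erase hi]

variable [FiniteDimensional 𝕜 V]

theorem codim_add_finrank (W : Submodule 𝕜 V) :
    codim W + Module.finrank 𝕜 W = Module.finrank 𝕜 V :=
  Submodule.finrank_quotient_add_finrank W

theorem codim_inf_add_codim_sup (P Q : Submodule 𝕜 V) :
    codim (P ⊓ Q) + codim (P ⊔ Q) = codim P + codim Q := by
  have h := Submodule.finrank_sup_add_finrank_inf_eq P Q
  have h1 := codim_add_finrank P
  have h2 := codim_add_finrank Q
  have h3 := codim_add_finrank (P ⊔ Q)
  have h4 := codim_add_finrank (P ⊓ Q)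
  omega

theorem codim_anti {P Q : Submodule 𝕜 V} (h : P ≤ Q) : codim Q ≤ codim P := by
  have h0 := Submodule.finrank_mono h
  have h1 := codim_add_finrank P
  have h2 := codim_add_finrank Q
  omega

@[simp] theorem codim_top : codim (⊤ : Submodule 𝕜 V) = 0 := by
  have := codim_add_finrank (⊤ : Submodule 𝕜 V)
  rw [finrank_top] at this
  omega

theorem codim_sup_span_singleton {P : Submodule 𝕜 V} {v : V} (hv : v ∉ P) :
    codim (P ⊔ Submodule.span 𝕜 {v}) + 1 = codim P := by
  have h0 := Submodule.finrank_sup_span_singleton hv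
  have h1 := codim_add_finrank P
  have h2 := codim_add_finrank (P ⊔ Submodule.span 𝕜 {v})
  omega

/-- Modularity for `P` and `(P + ⟨v⟩) ∩ Q`: they meet in `P ∩ Q`, and their sum lies in `P + ⟨v⟩`,
of codimension one less than `P`. -/
theorem codim_inf_le_codim_sup_span_singleton_inf {P : Submodule 𝕜 V} {v : V} (hv : v ∉ P)
    (Q : Submodule 𝕜 V) :
    codim (P ⊓ Q) ≤ codim ((P ⊔ Submodule.span 𝕜 {v}) ⊓ Q) + 1 := by
  have h1 := codim_inf_add_codim_sup P ((P ⊔ Submodule.span 𝕜 {v}) ⊓ Q)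
  rw [← inf_assoc, inf_sup_self] at h1
  have h2 : codim (P ⊔ Submodule.span 𝕜 {v}) ≤
      codim (P ⊔ (P ⊔ Submodule.span 𝕜 {v}) ⊓ Q) :=
    codim_anti (sup_le le_sup_left inf_le_left)
  have h3 := codim_sup_span_singleton hv
  omega

theorem isIntegralPolymatroid_arrangementRk (X : Fin m → Submodule 𝕜 V) :
    IsIntegralPolymatroid (arrangementRk X) where
  empty := by simp [arrangementRk]
  mono A B h := codim_anti (biInf_mono fun _ hi => h hi)
  submod A B := by
    have h := codim_inf_add_codim_sup (⨅ a ∈ A, X a) (⨅ a ∈ B, X a)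
    have h1 : codim (⨅ a ∈ A ∩ B, X a) ≤ codim ((⨅ a ∈ A, X a) ⊔ (⨅ a ∈ B, X a)) :=
      codim_anti (sup_le (biInf_mono fun i hi => (mem_inter.1 hi).1)
        (biInf_mono fun i hi => (mem_inter.1 hi).2))
    unfold arrangementRk
    rw [Finset.iInf_union]
    omega

/-- Enlarging one member `X i` of an arrangement with `b i < codim (X i)` by one dimension,
without violating the Rado conditions for `b` and `k`. -/
theorem exists_enlargement (X : Fin m → Submodule 𝕜 V) (b : Fin m → ℕ) (k : ℕ)
    (hk : ∀ A, k ≤ arrangementRk X A + ∑ j ∈ Aᶜ, b j) {i : Fin m} (hi : b i < codim (X i)) :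
    ∃ v, v ∉ X i ∧ ∀ A, k ≤
      arrangementRk (Function.update X i (X i ⊔ Submodule.span 𝕜 {v})) A + ∑ j ∈ Aᶜ, b j := by
  have hpoly := isIntegralPolymatroid_arrangementRk X
  have herase : ∀ (W : Submodule 𝕜 V) (A : Finset (Fin m)),
      ⨅ a ∈ A.erase i, Function.update X i W a = ⨅ a ∈ A.erase i, X a := fun W A =>
    biInf_congr fun a ha => by rw [Function.update_of_ne (ne_of_mem_erase ha)]
  have hnot : ∀ (W : Submodule 𝕜 V) (A : Finset (Fin m)), i ∉ A →
      arrangementRk (Function.update X i W) A = arrangementRk X A := fun W A hA => by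
    have := herase W A
    rw [erase_eq_of_notMem hA] at this
    rw [arrangementRk, this, arrangementRk]
  have hmem : ∀ (W : Submodule 𝕜 V) (A : Finset (Fin m)), i ∈ A →
      arrangementRk (Function.update X i W) A = codim (W ⊓ ⨅ a ∈ A.erase i, X a) :=
    fun W A hA => by rw [arrangementRk_eq_of_mem _ hA, herase, Function.update_self]
  by_cases hex : ∃ A, i ∈ A ∧ arrangementRk X A + ∑ j ∈ Aᶜ, b j = k
  -- Only tight sets containing `i` constrain `v`. By submodularity they are closed under
  -- intersection, so a smallest one `A₀` lies in all the others.
  · obtain ⟨A₀, hA₀, hmin⟩ := exists_min_image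
      (univ.filter fun A => i ∈ A ∧ arrangementRk X A + ∑ j ∈ Aᶜ, b j = k) card
      (by obtain ⟨A, hA⟩ := hex; exact ⟨A, by simpa using hA⟩)
    simp only [mem_filter, mem_univ, true_and] at hA₀ hmin
    obtain ⟨hiA₀, htight⟩ := hA₀
    have hsub : ∀ A, i ∈ A → arrangementRk X A + ∑ j ∈ Aᶜ, b j = k → A₀ ⊆ A := by
      intro A hiA hA
      have h1 := hpoly.submod A₀ A
      have h2 : ∑ j ∈ (A₀ ∪ A)ᶜ, b j + ∑ j ∈ (A₀ ∩ A)ᶜ, b j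
          = ∑ j ∈ A₀ᶜ, b j + ∑ j ∈ Aᶜ, b j := by
        rw [compl_union, compl_inter, add_comm, sum_union_inter]
      have h3 := hk (A₀ ∪ A)
      have h4 := hk (A₀ ∩ A)
      have h5 := hmin (A₀ ∩ A) ⟨mem_inter.2 ⟨hiA₀, hiA⟩, by omega⟩
      exact inter_eq_left.1 (eq_of_subset_of_card_le inter_subset_left h5)
    -- If the sum were `V`, codimensions would add; removing `i` from `A₀` would then replace `codim
    -- (X i)` by the smaller `b i` and violate the inequality for `A₀.erase i`.
    have hne : X i ⊔ ⨅ a ∈ A₀.erase i, X a ≠ ⊤ := by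
      intro htop
      have h1 := codim_inf_add_codim_sup (X i) (⨅ a ∈ A₀.erase i, X a)
      rw [htop, codim_top, ← arrangementRk_eq_of_mem X hiA₀] at h1
      have h2 := hk (A₀.erase i)
      rw [compl_erase, sum_insert (by simpa using hiA₀), arrangementRk] at h2
      omega
    obtain ⟨v, hv⟩ : ∃ v, v ∉ X i ⊔ ⨅ a ∈ A₀.erase i, X a := by
      by_contra! h
      exact hne (Submodule.eq_top_iff'.2 h)
    have hvi : v ∉ X i := fun h => hv (Submodule.mem_sup_left h)
    refine ⟨v, hvi, fun A => ?_⟩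
    by_cases hiA : i ∈ A
    · rw [hmem _ A hiA]
      have hkA := hk A
      by_cases hA : arrangementRk X A + ∑ j ∈ Aᶜ, b j = k
      -- For tight `A ⊇ A₀` the vector `v` avoids the smaller sum too, so the intersection is
      -- unchanged. For non-tight `A` a loss of one is affordable.
      · have hle : ⨅ a ∈ A.erase i, X a ≤ ⨅ a ∈ A₀.erase i, X a :=
          biInf_mono fun a ha => erase_subset_erase i (hsub A hiA hA) ha
        rw [sup_span_singleton_inf_eq fun h => hv (sup_le_sup_left hle _ h),
          ← arrangementRk_eq_of_mem X hiA]
        exact hkA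
      · have h1 := codim_inf_le_codim_sup_span_singleton_inf hvi (⨅ a ∈ A.erase i, X a)
        rw [← arrangementRk_eq_of_mem X hiA] at h1
        omega
    · rw [hnot _ A hiA]
      exact hk A
  · push Not at hex
    obtain ⟨v, hv⟩ : ∃ v, v ∉ X i := by
      by_contra! h
      rw [Submodule.eq_top_iff'.2 h, codim_top] at hi
      omega
    refine ⟨v, hv, fun A => ?_⟩
    by_cases hiA : i ∈ A
    · rw [hmem _ A hiA]
      have h1 := codim_inf_le_codim_sup_span_singleton_inf hv (⨅ a ∈ A.erase i, X a)
      rw [← arrangementRk_eq_of_mem X hiA] at h1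
      have h2 := hk A
      have h3 := hex A hiA
      omega
    · rw [hnot _ A hiA]
      exact hk A

/-- Rado's theorem for subspaces, in dual form. -/
theorem exists_le_codim_iInf (X : Fin m → Submodule 𝕜 V) (b : Fin m → ℕ) (k : ℕ)
    (hb : ∀ i, b i ≤ codim (X i)) (hk : ∀ A, k ≤ arrangementRk X A + ∑ j ∈ Aᶜ, b j) :
    ∃ Y : Fin m → Submodule 𝕜 V, (∀ i, X i ≤ Y i ∧ codim (Y i) = b i) ∧ k ≤ codim (⨅ i, Y i) := by
  -- Induction on the total excess of codimension; at excess zero, `Y = X` and the inequality for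
  -- `univ` is the claim.
  induction hn : ∑ i, (codim (X i) - b i) generalizing X with
  | zero =>
    refine ⟨X, fun i => ⟨le_rfl, ?_⟩, ?_⟩
    · have h1 := sum_eq_zero_iff.1 hn i (mem_univ i)
      have h2 := hb i
      omega
    · simpa [arrangementRk_univ] using hk univ
  | succ n ih =>
    obtain ⟨i, hi⟩ : ∃ i, b i < codim (X i) := by
      by_contra! h
      have : ∑ i, (codim (X i) - b i) = 0 :=
        sum_eq_zero fun i _ => Nat.sub_eq_zero_of_le (h i)
      omega
    obtain ⟨v, hv, hkv⟩ := exists_enlargement X b k hk hi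
    have hcodim := codim_sup_span_singleton hv
    obtain ⟨Y, hY, hYk⟩ := ih (Function.update X i (X i ⊔ Submodule.span 𝕜 {v}))
      (by
        intro j
        rcases eq_or_ne j i with rfl | hj
        · rw [Function.update_self]; omega
        · rw [Function.update_of_ne hj]; exact hb j)
      hkv
      (by
        rw [← add_sum_erase _ _ (mem_univ i)] at hn ⊢
        rw [Function.update_self, sum_congr rfl fun j hj => by
          rw [Function.update_of_ne (ne_of_mem_erase hj)]]
        omega)
    refine ⟨Y, fun j => ⟨?_, (hY j).2⟩, hYk⟩
    refine le_trans ?_ (hY j).1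
    rcases eq_or_ne j i with rfl | hj
    · rw [Function.update_self]; exact le_sup_left
    · rw [Function.update_of_ne hj]

/-- The easy half of Rado's theorem: subadditivity of the polymatroid of an optimal `Y`, together
with `X i ≤ Y i`. -/
theorem arrangementRho_le (X : Fin m → Submodule 𝕜 V) (b : Fin m → ℕ)
    (hb : ∀ i, b i ≤ codim (X i)) (A : Finset (Fin m)) :
    arrangementRho X b ≤ arrangementRk X A + ∑ j ∈ Aᶜ, b j := by
  obtain ⟨⟨Y, hY, hYk⟩, -⟩ := arrangementRho_isGreatest X b hb
  have h1 := (isIntegralPolymatroid_arrangementRk Y).le_add_sum A Aᶜ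
  rw [union_compl, arrangementRk_univ] at h1
  have h2 : arrangementRk Y A ≤ arrangementRk X A := codim_anti (iInf₂_mono fun i _ => (hY i).1)
  have h3 : ∑ j ∈ Aᶜ, arrangementRk Y {j} = ∑ j ∈ Aᶜ, b j :=
    sum_congr rfl fun j _ => by rw [arrangementRk_singleton, (hY j).2]
  omega

theorem arrangementRho_card_eq_liftRank {E : Type*} (X : Fin m → Submodule 𝕜 V) (π : E → Fin m)
    (S : Finset E) (hS : ∀ i, #(S.filter fun x => π x = i) ≤ codim (X i)) :
    arrangementRho X (fun i => #(S.filter fun x => π x = i)) = liftRank (arrangementRk X) π S := by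
  apply le_antisymm
  · obtain ⟨A, hA⟩ := exists_liftRank_eq (arrangementRk X) π S
    rw [hA, card_filter_notMem_eq_sum]
    exact arrangementRho_le X _ hS A
  · obtain ⟨Y, hY, hYk⟩ := exists_le_codim_iInf X (fun i => #(S.filter fun x => π x = i))
      (liftRank (arrangementRk X) π S) hS fun A => by
        rw [← card_filter_notMem_eq_sum]
        exact liftRank_le _ _ _ _
    exact hYk.trans ((arrangementRho_isGreatest X _ hS).2 ⟨Y, hY, rfl⟩)

end Codim

/-! ### The product of chains as a lattice of sets. -/

section ChainSet

variable {m : ℕ} {c : Fin m → ℕ} {E : Type*} [Fintype E] (e : (Σ i, Fin (c i)) ≃ E)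

theorem mem_chainSet {b : Fin m → ℕ} {x : E} :
    x ∈ chainSet e b ↔ ((e.symm x).2 : ℕ) < b (e.symm x).1 := by
  simp [chainSet]

theorem card_chainIndex_fibre (i : Fin m) :
    #(univ.filter fun x => chainIndex e x = i) = c i := by
  rw [← Fintype.card_subtype, ← Fintype.card_fin (c i)]
  refine Fintype.card_congr (((e.subtypeEquiv fun p => ?_).symm).trans
    (Equiv.sigmaSubtype i))
  simp [chainIndex]

theorem chainSet_union [DecidableEq E] (b b' : Fin m → ℕ) :
    chainSet e b ∪ chainSet e b' = chainSet e fun i => max (b i) (b' i) := by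
  ext x; simp [mem_chainSet]

theorem chainSet_inter [DecidableEq E] (b b' : Fin m → ℕ) :
    chainSet e b ∩ chainSet e b' = chainSet e fun i => min (b i) (b' i) := by
  ext x; simp [mem_chainSet]

theorem filter_chainIndex_mem_eq_chainSet (A : Finset (Fin m)) :
    (univ.filter fun x => chainIndex e x ∈ A) = chainSet e fun i => if i ∈ A then c i else 0 := by
  ext x
  rw [mem_chainSet, mem_filter]
  by_cases h : (e.symm x).1 ∈ A <;> simp [chainIndex, h]

theorem exists_erase_chainSet [DecidableEq E] {b : Fin m → ℕ} (hb : ∀ i, b i ≤ c i)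
    (hne : (chainSet e b).Nonempty) :
    ∃ x ∈ chainSet e b, ∃ b' : Fin m → ℕ, (∀ i, b' i ≤ c i) ∧
      (chainSet e b).erase x = chainSet e b' := by
  obtain ⟨y, hy⟩ := hne
  rw [mem_chainSet] at hy
  obtain ⟨i, hi⟩ : ∃ i, 0 < b i := ⟨_, Nat.zero_lt_of_lt hy⟩
  have hbi := hb i
  -- The element removed is the last one of a nonempty initial segment; indices start at 0, so it
  -- has index `b i - 1`.
  refine ⟨e ⟨i, ⟨b i - 1, by omega⟩⟩, ?_,
    Function.update b i (b i - 1), fun j => ?_, ?_⟩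
  · rw [mem_chainSet, Equiv.symm_apply_apply]
    exact Nat.sub_lt hi one_pos
  · rcases eq_or_ne j i with rfl | hj
    · rw [Function.update_self]; omega
    · rw [Function.update_of_ne hj]; exact hb j
  · ext x
    rw [mem_erase, mem_chainSet, mem_chainSet, ne_eq, ← Equiv.symm_apply_eq]
    obtain ⟨j, t⟩ := e.symm x
    rcases eq_or_ne j i with rfl | hj
    · simp only [Function.update_self, Sigma.mk.injEq, heq_eq_eq, true_and, Fin.ext_iff]
      omega
    · simp [hj]

end ChainSet

/-! ### The U-matroid of an arrangement. -/

section Arrangement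

variable {𝕜 V : Type*} [Field 𝕜] [AddCommGroup V] [Module 𝕜 V] [FiniteDimensional 𝕜 V]
  {m : ℕ} {c : Fin m → ℕ} {X : Fin m → Submodule 𝕜 V} {E : Type*} [Fintype E]

/-- Both sides depend on `S` only through its fibre sizes, which are at most `c i`, so Rado's
theorem applies to every `S`, in the lattice or not. -/
theorem arrangementUMatroid_rank_eq_liftRank (hX : ∀ i, codim (X i) = c i)
    (e : (Σ i, Fin (c i)) ≃ E) (S : Finset E) :
    (arrangementUMatroid X e).rank S = liftRank (arrangementRk X) (chainIndex e) S := by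
  refine arrangementRho_card_eq_liftRank X (chainIndex e) S fun i => ?_
  rw [hX i, ← card_chainIndex_fibre e i]
  exact card_le_card (filter_subset_filter _ (subset_univ S))

variable [DecidableEq E] {U : RankedLattice E}

theorem restrictsRank_of_same_arrangementUMatroid (hX : ∀ i, codim (X i) = c i)
    (e : (Σ i, Fin (c i)) ≃ E) (hU : U.Same (arrangementUMatroid X e)) :
    U.RestrictsRank (liftRank (arrangementRk X) (chainIndex e)) (chainIndex e) where
  empty_mem := by
    rw [hU.1]
    exact ⟨fun _ => 0, by simp, by simp [chainSet]⟩
  fibre_mem i := by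
    rw [hU.1]
    refine ⟨fun j => if j ∈ ({i} : Finset (Fin m)) then c j else 0, fun j => ?_, ?_⟩
    · dsimp only; split_ifs <;> simp
    · rw [← filter_chainIndex_mem_eq_chainSet]; simp
  univ_mem := by
    rw [hU.1]
    exact ⟨c, fun _ => le_rfl, by simp [chainSet]⟩
  union_mem := by
    rw [hU.1]
    rintro _ ⟨b, hb, rfl⟩ _ ⟨b', hb', rfl⟩
    exact ⟨_, fun i => max_le (hb i) (hb' i), chainSet_union e b b'⟩
  inter_mem := by
    rw [hU.1]
    rintro _ ⟨b, hb, rfl⟩ _ ⟨b', hb', rfl⟩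
    exact ⟨_, fun i => (min_le_left _ _).trans (hb i), chainSet_inter e b b'⟩
  rank_eq A hA := by rw [hU.2 A hA, arrangementUMatroid_rank_eq_liftRank hX]

theorem isUMatroid_of_same_arrangementUMatroid (hX : ∀ i, codim (X i) = c i)
    (e : (Σ i, Fin (c i)) ≃ E) (hU : U.Same (arrangementUMatroid X e)) : U.IsUMatroid := by
  have hR := restrictsRank_of_same_arrangementUMatroid hX e hU
  have hr := (isIntegralPolymatroid_arrangementRk X).isMatroidRank_liftRank (chainIndex e)
  refine ⟨hR.empty_mem, hR.univ_mem, hR.union_mem, hR.inter_mem, ?_, ?_, ?_, ?_, ?_⟩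
  · rw [hU.1]
    rintro _ ⟨b, hb, rfl⟩ hne
    exact exists_erase_chainSet e hb hne
  · rw [hR.rank_eq _ hR.empty_mem, hr.empty]
  · intro A hA B hB hAB
    rw [hR.rank_eq A hA, hR.rank_eq B hB]
    exact hr.mono A B hAB
  · intro A hA B hB
    rw [hR.rank_eq A hA, hR.rank_eq B hB, hR.rank_eq _ (hR.union_mem A hA B hB),
      hR.rank_eq _ (hR.inter_mem A hA B hB)]
    exact hr.submod A B
  · intro A hA x hx
    rw [hR.rank_eq A hA, hR.rank_eq _ hx]
    exact hr.insert_le A x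

end Arrangement

theorem mainTheorem9 {𝕜 V : Type*} [Field 𝕜] [AddCommGroup V] [Module 𝕜 V]
    [FiniteDimensional 𝕜 V] {m : ℕ} {c : Fin m → ℕ}
    (X : Fin m → Submodule 𝕜 V) (hX : ∀ i, codim (X i) = c i)
    {E : Type*} [Fintype E] [DecidableEq E] (e : (Σ i, Fin (c i)) ≃ E)
    (U : RankedLattice E) (hU : U.Same (arrangementUMatroid X e)) :
    U.IsUMatroid ∧
    (∃ M : Matroid E,
      IsMinimalMultisymmetricLift (arrangementRk X) (chainIndex e) M ∧
      U.IsGenerousMatroidExtension M) ∧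
    (∀ l : List E, U.ListsNonAtoms l → ∀ S : Finset E,
      (U.iteratedGenerousExtension l).rank S =
          liftRank (arrangementRk X) (chainIndex e) S ∧
      (U.iteratedGenerousExtension l).rank S =
          liftRank (fun A => U.rank (univ.filter fun x => chainIndex e x ∈ A))
            (chainIndex e) S) := by
  have hpoly := isIntegralPolymatroid_arrangementRk X
  have hr := hpoly.isMatroidRank_liftRank (chainIndex e)
  have hR := restrictsRank_of_same_arrangementUMatroid hX e hU
  have hclone : ∀ (S : Finset E) (a x : E), chainIndex e a = chainIndex e x → a ∉ S → x ∉ S →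
      liftRank (arrangementRk X) (chainIndex e) (insert a S) =
        liftRank (arrangementRk X) (chainIndex e) (insert x S) :=
    fun S a x => liftRank_insert_eq_insert _
  have hfibre : ∀ i, #(univ.filter fun x => chainIndex e x = i) = arrangementRk X {i} := fun i => by
    rw [card_chainIndex_fibre, arrangementRk_singleton, hX]
  have hlattice : ∀ l, U.ListsNonAtoms l → (U.iteratedGenerousExtension l).lattice = Set.univ :=
    fun l hl => hR.lattice_iteratedGenerousExtension hr hclone hl
  have hrank : ∀ l, U.ListsNonAtoms l → ∀ S, (U.iteratedGenerousExtension l).rank S =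
      liftRank (arrangementRk X) (chainIndex e) S := fun l hl S =>
    (RankedLattice.RestrictsRank.iteratedGenerousExtension hr hclone l hR).rank_eq S
      (hlattice l hl ▸ Set.mem_univ S)
  have hpre : (fun A => U.rank (univ.filter fun x => chainIndex e x ∈ A)) = arrangementRk X := by
    funext A
    rw [hR.rank_eq, hpoly.liftRank_preimage hfibre]
    rw [hU.1]
    refine ⟨_, fun j => ?_, filter_chainIndex_mem_eq_chainSet e A⟩
    split_ifs <;> simp
  obtain ⟨M, hME, hM⟩ := hr.exists_matroid
  refine ⟨isUMatroid_of_same_arrangementUMatroid hX e hU,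
    ⟨M, ⟨hpoly, hfibre, hME, hM⟩, hME, fun l hl => ⟨hlattice l hl, fun S => ?_⟩⟩,
    fun l hl S => ⟨hrank l hl S, ?_⟩⟩
  · rw [hM, hrank l hl]
  · rw [hpre, hrank l hl]
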